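/- Let $(\Omega,\mathcal F,P)$ be a complete probability space and let $\mathcal X\subset\mathbb R$ be countably infinite and bounded. Let $(\lambda_x)_{x\in\mathcal X}$ be positive real numbers, and let $(\mathcal Y_x)_{x\in\mathcal X}$ be independent random closed subsets of $\mathbb R$ (with respect to the Borel $\sigma$-algebra of the Fell topology) such that, for each $x\in\mathcal X$, $\mathcal Y_x$ is a homogeneous Poisson point process on $\mathbb R$ with intensity $\lambda_x$. Define the random set $$V:=\mathbb R^2\setminus\bigcup_{x\in\mathcal X}\bigl(\{x\}\times(\mathbb R\setminus\mathcal Y_x)\bigr)=\{(x,y)\in\mathbb R^2 : x\in\mathcal X\Rightarrow y\in\mathcal Y_x\}.$$ If $$\sum_{x\in\mathcal X}e^{-\lambda_x\varepsilon}<\infty\quad\text{for every }\varepsilon>0,$$ then $V$ is almost surely path-connected. Otherwise $V$ is almost surely not path-connected. -/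

import Mathlib

open MeasureTheory ProbabilityTheory TopologicalSpace
open scoped NNReal ENNReal

/-- The Fell topology on the space of closed subsets of `ℝ`: it is generated by the sets
`{F | F ∩ K = ∅}` with `K` compact and `{F | F ∩ G ≠ ∅}` with `G` open. -/
def fellTopology : TopologicalSpace (Closeds ℝ) :=
  TopologicalSpace.generateFrom
    ({s | ∃ K : Set ℝ, IsCompact K ∧ s = {F : Closeds ℝ | (F : Set ℝ) ∩ K = ∅}} ∪
      {s | ∃ G : Set ℝ, IsOpen G ∧ s = {F : Closeds ℝ | ((F : Set ℝ) ∩ G).Nonempty}})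

/-- The Borel `σ`-algebra of the Fell topology on the closed subsets of `ℝ`. -/
def fellBorel : MeasurableSpace (Closeds ℝ) :=
  @borel (Closeds ℝ) fellTopology

/-- A random closed subset of `ℝ`: a random variable with values in the closed subsets of `ℝ`
equipped with the Borel `σ`-algebra of the Fell topology. -/
def IsRandomClosedSet {Ω : Type*} [MeasurableSpace Ω] (Y : Ω → Closeds ℝ) : Prop :=
  Measurable[_, fellBorel] Y

/-- The number of points (possibly `∞`) of the random set `Y` in `B`. -/
noncomputable def pointCount {Ω : Type*} (Y : Ω → Closeds ℝ) (B : Set ℝ) (ω : Ω) : ℕ∞ :=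
  ((Y ω : Set ℝ) ∩ B).encard

/-- The random closed set `Y` is (the set of points of) a homogeneous Poisson point process on
`ℝ` with intensity `r`: the number of points in a bounded Borel set `B` is Poisson distributed
with parameter `r * |B|` (in particular it is almost surely finite), and the numbers of points in
finitely many pairwise disjoint bounded Borel sets are independent. -/
structure IsHomogeneousPoissonProcess {Ω : Type*} [MeasurableSpace Ω] (P : Measure Ω)
    (r : ℝ≥0) (Y : Ω → Closeds ℝ) : Prop where
  isRandomClosedSet : IsRandomClosedSet Y
  hasLaw_pointCount : ∀ B : Set ℝ, MeasurableSet B → Bornology.IsBounded B →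
    HasLaw (pointCount Y B)
      ((poissonMeasure (r * (volume B).toNNReal)).map (Nat.cast : ℕ → ℕ∞)) P
  iIndepFun_pointCount : ∀ (n : ℕ) (B : Fin n → Set ℝ), (∀ i, MeasurableSet (B i)) →
    (∀ i, Bornology.IsBounded (B i)) → Pairwise (fun i j => Disjoint (B i) (B j)) →
    iIndepFun (fun i => pointCount Y (B i)) P

/-- The members of the family `Y` of random closed sets are independent. -/
def IndepRandomClosedSets {Ω ι : Type*} [MeasurableSpace Ω] (P : Measure Ω)
    (Y : ι → Ω → Closeds ℝ) : Prop :=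
  iIndepFun (m := fun _ => fellBorel) Y P

/-- The perforated plane `ℝ² \ ⋃ x ∈ X, {x} × (Y x)ᶜ`. -/
def perforatedPlane (X : Set ℝ) (Y : X → Closeds ℝ) : Set (ℝ × ℝ) :=
  Set.univ \ ⋃ x : X, ({(x : ℝ)} : Set ℝ) ×ˢ ((Y x : Set ℝ)ᶜ)

theorem mem_perforatedPlane_iff (X : Set ℝ) (Y : X → Closeds ℝ) (p : ℝ × ℝ) :
    p ∈ perforatedPlane X Y ↔ ∀ h : p.1 ∈ X, p.2 ∈ Y ⟨p.1, h⟩ := by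
  obtain ⟨a, b⟩ := p
  simp [perforatedPlane]

open Set Filter Topology

/-! ### Continuous selections -/

/-! Summable case: by Borel–Cantelli, almost surely each cell of each grid is missed by only
finitely many fibres. Hence at every precision all but finitely many fibres are dense on bounded
sets, and successive corrections at finitely many points converge uniformly to a continuous
selection (`exists_continuous_selection`), whose graph lies in `V`. Prescribing its values at two
abscissae joins points of `V`. Divergent case: boundedness of `X` localizes the divergence to one
side of some `p` (`exists_one_sided_not_summable`). By the second Borel–Cantelli lemma, fibres
arbitrarily close to `p` on that side miss any given interval of length `ε` with rational centre. A
path across `p` must traverse those fibres at nearly constant height (`exists_crossing_height`), so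
none exists. -/

/-- A real function bounded by `ε` on a finite set extends to a continuous function bounded by `ε`. -/
theorem exists_boundedContinuous_eqOn_finite {S : Set ℝ} (hS : S.Finite) (c : ℝ → ℝ) {ε : ℝ}
    (hε : 0 ≤ ε) (hc : ∀ t, |c t| ≤ ε) :
    ∃ h : BoundedContinuousFunction ℝ ℝ, ‖h‖ ≤ ε ∧ ∀ t ∈ S, h t = c t := by
  have := hS.to_subtype
  obtain ⟨g, hg, hgc⟩ := ContinuousMap.exists_restrict_eq_forall_mem_of_closed
    (s := S) (t := Icc (-ε) ε) ⟨fun t : S => c t, continuous_of_discreteTopology⟩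
    (fun t => abs_le.1 (hc t)) ⟨0, by simpa using hε⟩ hS.isClosed
  refine ⟨BoundedContinuousFunction.ofNormedAddCommGroup g g.continuous ε
    fun t => abs_le.2 (hg t), BoundedContinuousFunction.norm_ofNormedAddCommGroup_le _ hε _, ?_⟩
  intro t ht
  exact congrArg (fun k : C(S, ℝ) => k ⟨t, ht⟩) hgc

/-- `g` takes values in `T` on the finite set `S` and is `ε`-close to `T` elsewhere. -/
structure IsApproxSelection (T : ℝ → Set ℝ) (g : BoundedContinuousFunction ℝ ℝ) (S : Set ℝ)
    (ε : ℝ) : Prop where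
  finite : S.Finite
  mem : ∀ t ∈ S, g t ∈ T t
  close : ∀ t ∉ S, ∃ z ∈ T t, |z - g t| < ε

/-- The correction vanishes on `S`, so values already in `T` stay frozen; since it has norm at most
`ε`, the iterates will be Cauchy when the precisions are summable. -/
theorem IsApproxSelection.exists_refinement {T : ℝ → Set ℝ}
    (hT : ∀ M ε : ℝ, 0 < ε → {t | ∃ y, |y| ≤ M ∧ ∀ z ∈ T t, ε ≤ |z - y|}.Finite)
    {g : BoundedContinuousFunction ℝ ℝ} {S : Set ℝ} {ε ε' : ℝ} (h : IsApproxSelection T g S ε)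
    (hε : 0 < ε) (hε' : 0 < ε') :
    ∃ g' S', IsApproxSelection T g' S' ε' ∧ S ⊆ S' ∧ (∀ t ∈ S, g' t = g t) ∧ dist g g' ≤ ε := by
  classical
  choose! z hzT hzg using h.close
  -- The bound `‖g‖ + ε` dominates the corrected function, so off `S'` its value is automatically
  -- `ε'`-close to `T t`.
  set S' := S ∪ {t | ∃ y, |y| ≤ ‖g‖ + ε ∧ ∀ z ∈ T t, ε' ≤ |z - y|} with hS'
  have hfin : S'.Finite := h.finite.union (hT _ _ hε')
  obtain ⟨k, hk, hkc⟩ := exists_boundedContinuous_eqOn_finite hfin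
    (fun t => if t ∈ S then 0 else z t - g t) hε.le (fun t => by
      by_cases ht : t ∈ S
      · simpa [ht] using hε.le
      · simpa [ht] using (hzg t ht).le)
  refine ⟨g + k, S', ⟨hfin, ?_, ?_⟩, subset_union_left, ?_, ?_⟩
  · intro t ht
    by_cases htS : t ∈ S
    · simpa [hkc t ht, htS] using h.mem t htS
    · simpa [hkc t ht, htS] using hzT t htS
  · intro t ht
    by_contra! hcon
    refine ht (Or.inr ⟨(g + k) t, ?_, hcon⟩)
    calc |(g + k) t| ≤ ‖g + k‖ := (g + k).norm_coe_le_norm t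
      _ ≤ ‖g‖ + ‖k‖ := norm_add_le _ _
      _ ≤ ‖g‖ + ε := by gcongr
  · intro t ht
    simp [hkc t (Or.inl ht), ht]
  · simpa [dist_eq_norm] using hk

/-- A closed-valued map which is uniformly dense on bounded sets, up to finitely many exceptions for
every precision, has a continuous selection. -/
theorem exists_continuous_selection {T : ℝ → Set ℝ} (hclosed : ∀ t, IsClosed (T t))
    (hne : ∀ t, (T t).Nonempty)
    (hT : ∀ M ε : ℝ, 0 < ε → {t | ∃ y, |y| ≤ M ∧ ∀ z ∈ T t, ε ≤ |z - y|}.Finite) :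
    ∃ g : ℝ → ℝ, Continuous g ∧ ∀ t, g t ∈ T t := by
  -- `C` is the initial precision: the zero function with no frozen points must qualify.
  obtain ⟨C, hC0, hC⟩ : ∃ C : ℝ, 0 < C ∧ ∀ t, ∃ z ∈ T t, |z| < C := by
    choose z hz using hne
    obtain ⟨C, hC⟩ := ((hT 0 1 one_pos).image fun t => |z t|).bddAbove
    refine ⟨max C 0 + 1, by positivity, fun t => ?_⟩
    by_cases ht : t ∈ {t | ∃ y, |y| ≤ (0 : ℝ) ∧ ∀ z ∈ T t, 1 ≤ |z - y|}
    · exact ⟨z t, hz t, by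
        have := hC (mem_image_of_mem _ ht)
        have := le_max_left C 0
        linarith⟩
    · simp only [mem_ofPred_eq, not_exists, not_and] at ht
      have h0 := ht 0 (by simp)
      push Not at h0
      obtain ⟨w, hw, hw1⟩ := h0
      refine ⟨w, hw, ?_⟩
      have := le_max_right C 0
      rw [sub_zero] at hw1
      linarith
  let St := {p : BoundedContinuousFunction ℝ ℝ × Set ℝ × ℝ //
    IsApproxSelection T p.1 p.2.1 p.2.2 ∧ 0 < p.2.2}
  have step : ∀ s : St, ∃ s' : St, s'.1.2.2 = s.1.2.2 / 2 ∧ s.1.2.1 ⊆ s'.1.2.1 ∧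
      (∀ t ∈ s.1.2.1, s'.1.1 t = s.1.1 t) ∧ dist s.1.1 s'.1.1 ≤ s.1.2.2 := by
    rintro ⟨⟨g, S, ε⟩, hs, hε⟩
    obtain ⟨g', S', h1, h2, h3, h4⟩ := hs.exists_refinement hT hε (half_pos hε)
    exact ⟨⟨⟨g', S', ε / 2⟩, h1, half_pos hε⟩, rfl, h2, h3, h4⟩
  choose next hnε hnS hng hnd using step
  let s : ℕ → St := fun n => next^[n]
    ⟨⟨0, ∅, C⟩, ⟨finite_empty, by simp, fun t _ => by simpa using hC t⟩, hC0⟩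
  have hs : ∀ n, s (n + 1) = next (s n) := fun n => Function.iterate_succ_apply' _ _ _
  have hε : ∀ n, (s n).1.2.2 = C * (1 / 2) ^ n := by
    intro n
    induction n with
    | zero => simp [s]
    | succ n ih => rw [hs, hnε, ih]; ring
  have hcauchy : CauchySeq fun n => (s n).1.1 :=
    cauchySeq_of_le_geometric (1 / 2) C (by norm_num) fun n => by
      rw [← hε n, hs]
      exact hnd _
  obtain ⟨g, hg⟩ := cauchySeq_tendsto_of_complete hcauchy
  have hgt : ∀ t, Tendsto (fun n => (s n).1.1 t) atTop (𝓝 (g t)) := fun t =>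
    ((continuous_eval_const t).tendsto g).comp hg
  refine ⟨g, g.continuous, fun t => ?_⟩
  -- Either `t` is eventually frozen at a value in `T t`, or points of `T t` approach the limit;
  -- closedness settles both.
  by_cases ht : ∃ n, t ∈ (s n).1.2.1
  · obtain ⟨n, hn⟩ := ht
    have key : ∀ m, n ≤ m → t ∈ (s m).1.2.1 := by
      intro m hm
      induction m, hm using Nat.le_induction with
      | base => exact hn
      | succ m _ ih => rw [hs]; exact hnS _ ih
    exact (hclosed t).mem_of_tendsto (hgt t)
      (eventually_atTop.2 ⟨n, fun m hm => (s m).2.1.mem t (key m hm)⟩)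
  · push Not at ht
    choose z hz hzd using fun n => (s n).2.1.close t (ht n)
    refine (hclosed t).mem_of_tendsto (f := z) (b := atTop) ?_ (Eventually.of_forall hz)
    have h0 : Tendsto (fun n => z n - (s n).1.1 t) atTop (𝓝 0) := by
      refine squeeze_zero_norm (fun n => (hzd n).le) ?_
      simp_rw [hε]
      simpa using (tendsto_pow_atTop_nhds_zero_of_lt_one (r := (1 / 2 : ℝ)) (by norm_num)
        (by norm_num)).const_mul C
    simpa using h0.add (hgt t)

/-- Under the hypotheses of `exists_continuous_selection`, points of the graph of `T` with distinct
abscissae are joined within the graph. -/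
theorem joinedIn_graph_of_fst_ne {T : ℝ → Set ℝ} (hclosed : ∀ t, IsClosed (T t))
    (hne : ∀ t, (T t).Nonempty)
    (hT : ∀ M ε : ℝ, 0 < ε → {t | ∃ y, |y| ≤ M ∧ ∀ z ∈ T t, ε ≤ |z - y|}.Finite)
    {p q : ℝ × ℝ} (hp : p.2 ∈ T p.1) (hq : q.2 ∈ T q.1) (hpq : p.1 ≠ q.1) :
    JoinedIn {r : ℝ × ℝ | r.2 ∈ T r.1} p q := by
  classical
  -- Altering two fibres keeps the exceptional sets finite and forces the selection through `p` and
  -- `q`.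
  let T' : ℝ → Set ℝ := Function.update (Function.update T p.1 {p.2}) q.1 {q.2}
  have hTp : T' p.1 = {p.2} := by simp [T', hpq]
  have hTq : T' q.1 = {q.2} := by simp [T']
  have hTt : ∀ t, t ≠ p.1 → t ≠ q.1 → T' t = T t := fun t h1 h2 => by simp [T', h1, h2]
  have cases_T' : ∀ t, t = p.1 ∨ t = q.1 ∨ (t ≠ p.1 ∧ t ≠ q.1) := by intro t; tauto
  obtain ⟨g, hgc, hg⟩ := exists_continuous_selection (T := T')
    (fun t => by
      rcases cases_T' t with rfl | rfl | ⟨h1, h2⟩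
      · rw [hTp]; exact isClosed_singleton
      · rw [hTq]; exact isClosed_singleton
      · rw [hTt t h1 h2]; exact hclosed t)
    (fun t => by
      rcases cases_T' t with rfl | rfl | ⟨h1, h2⟩
      · rw [hTp]; exact singleton_nonempty _
      · rw [hTq]; exact singleton_nonempty _
      · rw [hTt t h1 h2]; exact hne t)
    (fun M ε hε => by
      refine ((hT M ε hε).union ((finite_singleton p.1).union (finite_singleton q.1))).subset ?_
      intro t ht
      rcases cases_T' t with rfl | rfl | ⟨h1, h2⟩
      · simp
      · simp
      · left
        simpa [hTt t h1 h2] using ht)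
  have hgp : g p.1 = p.2 := by simpa [hTp] using hg p.1
  have hgq : g q.1 = q.2 := by simpa [hTq] using hg q.1
  have hpath : IsPathConnected ((fun t : ℝ => (t, g t)) '' univ) :=
    isPathConnected_univ.image (by fun_prop)
  refine (hpath.joinedIn p ⟨p.1, mem_univ _, by simp [hgp]⟩ q
    ⟨q.1, mem_univ _, by simp [hgq]⟩).mono ?_
  rintro _ ⟨t, -, rfl⟩
  rcases cases_T' t with rfl | rfl | ⟨h1, h2⟩
  · simpa [hgp] using hp
  · simpa [hgq] using hq
  · simpa [hTt t h1 h2] using hg t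

/-- If all fibres are nonempty and every interval `[k / (n + 1), (k + 1) / (n + 1)]` is missed by
only finitely many of them, then the perforated plane is path-connected. -/
theorem isPathConnected_perforatedPlane {X : Set ℝ} (hX : BddAbove X) {F : X → Closeds ℝ}
    (hne : ∀ x, (F x : Set ℝ).Nonempty)
    (hfin : ∀ (n : ℕ) (k : ℤ),
      {x | (F x : Set ℝ) ∩ Icc ((k : ℝ) / (n + 1)) (k / (n + 1) + 1 / (n + 1)) = ∅}.Finite) :
    IsPathConnected (perforatedPlane X F) := by
  let T : ℝ → Set ℝ := fun t => {y | ∀ h : t ∈ X, y ∈ F ⟨t, h⟩}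
  have hV : perforatedPlane X F = {r : ℝ × ℝ | r.2 ∈ T r.1} := by
    ext r
    exact mem_perforatedPlane_iff X F r
  have hTX : ∀ x : X, T x = F x := fun x => by ext y; simp [T]
  have hTc : ∀ t, t ∉ X → T t = univ := fun t ht => by ext y; simp [T, ht]
  have hclosed : ∀ t, IsClosed (T t) := fun t => by
    by_cases ht : t ∈ X
    · rw [hTX ⟨t, ht⟩]; exact (F _).isClosed
    · rw [hTc t ht]; exact isClosed_univ
  have hTne : ∀ t, (T t).Nonempty := fun t => by
    by_cases ht : t ∈ X
    · rw [hTX ⟨t, ht⟩]; exact hne _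
    · rw [hTc t ht]; exact univ_nonempty
  have hT : ∀ M ε : ℝ, 0 < ε → {t | ∃ y, |y| ≤ M ∧ ∀ z ∈ T t, ε ≤ |z - y|}.Finite := by
    intro M ε hε
    obtain ⟨n, hn⟩ := exists_nat_one_div_lt hε
    have hn0 : (0 : ℝ) < n + 1 := by positivity
    have hbig : (⋃ k ∈ Icc ⌊-M * (n + 1)⌋ ⌊M * (n + 1)⌋, ((↑) : X → ℝ) ''
        {x | (F x : Set ℝ) ∩ Icc ((k : ℝ) / (n + 1)) (k / (n + 1) + 1 / (n + 1)) = ∅}).Finite :=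
      (finite_Icc _ _).biUnion fun k _ => (hfin n k).image _
    refine hbig.subset ?_
    rintro t ⟨y, hy, hyz⟩
    by_cases ht : t ∈ X
    · rw [abs_le] at hy
      have h1 : ((⌊y * (n + 1)⌋ : ℤ) : ℝ) / (n + 1) ≤ y := by
        rw [div_le_iff₀ hn0]; exact Int.floor_le _
      have h2 : y < (⌊y * (n + 1)⌋ : ℤ) / (n + 1) + 1 / (n + 1) := by
        rw [← add_div, lt_div_iff₀ hn0]; exact Int.lt_floor_add_one _
      refine mem_biUnion (x := ⌊y * (n + 1)⌋)
        ⟨Int.floor_mono (by nlinarith), Int.floor_mono (by nlinarith)⟩ ⟨⟨t, ht⟩, ?_, rfl⟩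
      rw [mem_ofPred_eq, eq_empty_iff_forall_notMem]
      rintro z ⟨hz, hz1, hz2⟩
      have := hyz z (by rw [hTX ⟨t, ht⟩]; exact hz)
      have : |z - y| ≤ 1 / (n + 1) := abs_le.2 ⟨by linarith, by linarith⟩
      linarith
    · exfalso
      have := hyz y (by rw [hTc t ht]; trivial)
      simp at this
      linarith
  obtain ⟨b, hb⟩ := hX
  have h1 : b + 1 ∉ X := fun h => by linarith [hb h]
  have h2 : b + 2 ∉ X := fun h => by linarith [hb h]
  have m1 : (0 : ℝ) ∈ T (b + 1) := by rw [hTc _ h1]; trivial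
  have m2 : (0 : ℝ) ∈ T (b + 2) := by rw [hTc _ h2]; trivial
  rw [hV]
  refine ⟨(b + 1, 0), m1, fun {q} hq => ?_⟩
  -- Equal abscissae require a detour through the free line over `b + 2`.
  by_cases hqb : b + 1 = q.1
  · exact (joinedIn_graph_of_fst_ne hclosed hTne hT (p := (b + 1, 0)) (q := (b + 2, 0)) m1 m2
      (by simp)).trans
      (joinedIn_graph_of_fst_ne hclosed hTne hT (p := (b + 2, 0)) m2 hq (by simp [← hqb]))
  · exact joinedIn_graph_of_fst_ne hclosed hTne hT (p := (b + 1, 0)) m1 hq hqb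

/-! ### Obstruction to path-connectedness -/

/-- After its last visit to `(-∞, 0]`, the curve `(u, v)` crosses all small positive abscissae at
heights close to a fixed one. -/
theorem exists_crossing_height {u v : ℝ → ℝ} (hu : Continuous u) (hv : Continuous v)
    (h0 : u 0 ≤ 0) (h1 : 0 < u 1) :
    ∃ y, ∀ ε > 0, ∃ η > 0, ∀ x, 0 < x → x < η → ∃ t, u t = x ∧ |v t - y| < ε := by
  have hcomp : IsCompact (Icc (0 : ℝ) 1 ∩ u ⁻¹' Iic 0) :=
    isCompact_Icc.inter_right (isClosed_Iic.preimage hu)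
  obtain ⟨τ, ⟨⟨hτ0, hτ1⟩, huτ⟩, hmax⟩ := hcomp.exists_isGreatest ⟨0, by simp, h0⟩
  have hτlt : τ < 1 := lt_of_le_of_ne hτ1 (by rintro rfl; exact absurd huτ (not_le.2 h1))
  refine ⟨v τ, fun ε hε => ?_⟩
  obtain ⟨δ, hδ, hvδ⟩ := Metric.continuous_iff.1 hv τ ε hε
  have hlt : τ < min 1 (τ + δ / 2) := lt_min hτlt (by linarith)
  refine ⟨u (min 1 (τ + δ / 2)), ?_, fun x hx0 hx => ?_⟩
  · by_contra! hcon
    exact absurd (hmax ⟨⟨hτ0.trans hlt.le, min_le_left _ _⟩, hcon⟩) (not_le.2 hlt)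
  · obtain ⟨t, ⟨ht1, ht2⟩, htx⟩ :=
      intermediate_value_Icc hlt.le hu.continuousOn ⟨(show u τ ≤ 0 from huτ).trans hx0.le, hx.le⟩
    refine ⟨t, htx, hvδ t ?_⟩
    have := ht2.trans (min_le_right _ _)
    rw [Real.dist_eq, abs_of_nonneg (by linarith)]
    linarith

/-- If arbitrarily close to `p`, on one fixed side, there are fibres missing any prescribed
interval of length `ε`, then the perforated plane is not path-connected. -/
theorem not_isPathConnected_perforatedPlane {X : Set ℝ} (hX : Bornology.IsBounded X)
    {F : X → Closeds ℝ} {p s ε : ℝ} (hs : s = 1 ∨ s = -1) (hε : 0 < ε)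
    (h : ∀ (n : ℕ) (q : ℚ), ∃ x : X, (0 < s * (x - p) ∧ s * (x - p) < 1 / (n + 1)) ∧
      (F x : Set ℝ) ∩ Icc (q - ε / 2 : ℝ) (q - ε / 2 + ε) = ∅) :
    ¬ IsPathConnected (perforatedPlane X F) := by
  intro hpc
  obtain ⟨R, hR0, hR⟩ := hX.exists_pos_norm_lt
  have hmem : ∀ c y, R + |p| ≤ |c| → (c, y) ∈ perforatedPlane X F := by
    intro c y hc
    rw [mem_perforatedPlane_iff]
    intro hcX
    have := hR c hcX
    rw [Real.norm_eq_abs] at this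
    linarith [abs_nonneg p]
  have hp1 := le_abs_self p
  have hp2 := neg_abs_le p
  have hRp : 0 < R + |p| := by positivity
  have hs2 : s * s = 1 := by rcases hs with rfl | rfl <;> norm_num
  have hs1 : |s| = 1 := by rcases hs with rfl | rfl <;> norm_num
  obtain ⟨γ, hγ⟩ := hpc.joinedIn (-s * (R + |p|), 0)
    (hmem _ _ (by simp [abs_mul, hs1, abs_of_pos hRp])) (s * (R + |p|), 0)
    (hmem _ _ (by simp [abs_mul, hs1, abs_of_pos hRp]))
  have hext : ∀ t, γ.extend t ∈ perforatedPlane X F := fun t => by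
    have : γ.extend t ∈ range γ := by rw [← γ.extend_range]; exact mem_range_self t
    obtain ⟨t', ht'⟩ := this
    rw [← ht']
    exact hγ t'
  -- The factor `s` makes the bad side of `p` the positive one.
  obtain ⟨y, hy⟩ := exists_crossing_height (u := fun t => s * ((γ.extend t).1 - p))
    (v := fun t => (γ.extend t).2) (by fun_prop) (by fun_prop)
    (by simp only [Path.extend_zero]; rcases hs with rfl | rfl <;> linarith)
    (by simp only [Path.extend_one]; rcases hs with rfl | rfl <;> linarith)
  obtain ⟨η, hη, hcross⟩ := hy (ε / 4) (by linarith)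
  obtain ⟨n, hn⟩ := exists_nat_one_div_lt hη
  -- Both errors are below `ε / 4`, so the crossing height is within `ε / 2` of `q`.
  obtain ⟨q, hq1, hq2⟩ := exists_rat_btwn (show y - ε / 4 < y by linarith)
  obtain ⟨x, ⟨hx0, hx1⟩, hxF⟩ := h n q
  obtain ⟨t, htx, hty⟩ := hcross _ hx0 (hx1.trans hn)
  have hfst : (γ.extend t).1 = x := by
    have : s * (s * ((γ.extend t).1 - p)) = s * (s * (x - p)) := congrArg (s * ·) htx
    rw [← mul_assoc, ← mul_assoc, hs2] at this
    linarith
  have hF := (mem_perforatedPlane_iff X F _).1 (hext t) (hfst ▸ x.2)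
  have hx' : (⟨(γ.extend t).1, hfst ▸ x.2⟩ : X) = x := Subtype.ext hfst
  rw [hx'] at hF
  rw [abs_lt] at hty
  exact (eq_empty_iff_forall_notMem.1 hxF) _ ⟨hF, by linarith [hty.1], by linarith [hty.2]⟩

/-! ### Localization of divergence -/

/-- A divergent series of nonnegative terms indexed by a bounded set diverges in all one-sided
neighbourhoods of some point. -/
theorem exists_one_sided_not_summable {X : Set ℝ} (hX : Bornology.IsBounded X) {f : X → ℝ}
    (hf : ∀ x, 0 ≤ f x) (hsum : ¬ Summable f) :
    ∃ p s : ℝ, (s = 1 ∨ s = -1) ∧ ∀ η > 0,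
      ¬ Summable ({x : X | 0 < s * (x - p) ∧ s * (x - p) < η}.indicator f) := by
  by_contra! hcon
  apply hsum
  obtain ⟨R, -, hR⟩ := hX.exists_pos_norm_le
  have hmono : ∀ ⦃A B : Set X⦄, A ⊆ B → Summable (B.indicator f) → Summable (A.indicator f) :=
    fun A B hAB hB => Summable.of_nonneg_of_le (fun x => indicator_nonneg (fun x _ => hf x) x)
      (fun x => indicator_le_indicator_of_subset hAB hf x) hB
  have hunion : ∀ ⦃A B : Set X⦄, Summable (A.indicator f) → Summable (B.indicator f) →
      Summable ((A ∪ B).indicator f) := by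
    intro A B hA hB
    refine Summable.of_nonneg_of_le (fun x => indicator_nonneg (fun x _ => hf x) x) (fun x => ?_)
      (hA.add hB)
    have := congrFun (indicator_union_add_inter f A B) x
    have h0 : 0 ≤ (A ∩ B).indicator f x := indicator_nonneg (fun x _ => hf x) x
    simp only [Pi.add_apply] at this
    linarith
  -- Compactness of `[-R, R]` passes from local summability to global.
  have key : Summable ((((↑) : X → ℝ) ⁻¹' Icc (-R) R).indicator f) := by
    refine isCompact_Icc.induction_on
      (p := fun U => Summable ((((↑) : X → ℝ) ⁻¹' U).indicator f)) ?_ ?_ ?_ ?_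
    · simp [summable_zero]
    · exact fun U W hUW => hmono (preimage_mono hUW)
    · exact fun U W hU hW => hunion hU hW
    · intro p _
      obtain ⟨η₁, hη₁, h₁⟩ := hcon p 1 (Or.inl rfl)
      obtain ⟨η₂, hη₂, h₂⟩ := hcon p (-1) (Or.inr rfl)
      refine ⟨Ioo (p - η₂) (p + η₁),
        mem_nhdsWithin_of_mem_nhds (Ioo_mem_nhds (by linarith) (by linarith)), ?_⟩
      have h₀ : Summable ({x : X | (x : ℝ) = p}.indicator f) := by
        refine summable_of_hasFiniteSupport (Set.Finite.subset (s := {x : X | (x : ℝ) = p}) ?_ ?_)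
        · exact Set.Subsingleton.finite fun x hx y hy => Subtype.ext (hx.trans hy.symm)
        · exact Function.support_subset_iff'.2 fun x hx => indicator_of_notMem hx f
      refine hmono ?_ (hunion (hunion h₁ h₂) h₀)
      rintro x ⟨hx1, hx2⟩
      rcases lt_trichotomy (x : ℝ) p with hx | hx | hx
      · exact Or.inl (Or.inr ⟨by linarith, by linarith⟩)
      · exact Or.inr hx
      · exact Or.inl (Or.inl ⟨by linarith, by linarith⟩)
  convert key using 1
  rw [eq_comm, indicator_eq_self]
  exact fun x _ => abs_le.1 (hR x x.2)

/-! ### Void events -/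

theorem measurableSet_fellBorel_inter_eq_empty {K : Set ℝ} (hK : IsCompact K) :
    MeasurableSet[fellBorel] {F : Closeds ℝ | (F : Set ℝ) ∩ K = ∅} :=
  MeasurableSpace.measurableSet_generateFrom
    (TopologicalSpace.isOpen_generateFrom_of_mem (Or.inl ⟨K, hK, rfl⟩))

theorem IsHomogeneousPoissonProcess.measure_inter_Icc_eq_empty {Ω : Type*} [MeasurableSpace Ω]
    {P : Measure Ω} {r : ℝ≥0} {Y : Ω → Closeds ℝ} (hY : IsHomogeneousPoissonProcess P r Y)
    (a : ℝ) {l : ℝ} (hl : 0 ≤ l) :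
    P {ω | (Y ω : Set ℝ) ∩ Icc a (a + l) = ∅} = ENNReal.ofReal (Real.exp (-(r : ℝ) * l)) := by
  have h := (hY.hasLaw_pointCount (Icc a (a + l)) measurableSet_Icc
    (Metric.isBounded_Icc _ _)).measure_eq (p := fun n => n = 0) (MeasurableSet.of_discrete)
  have h1 : {ω | pointCount Y (Icc a (a + l)) ω = 0} = {ω | (Y ω : Set ℝ) ∩ Icc a (a + l) = ∅} := by
    ext ω
    simp [pointCount]
  rw [h1] at h
  rw [h, Measure.map_apply Measurable.of_discrete MeasurableSet.of_discrete]
  have h2 : (Nat.cast : ℕ → ℕ∞) ⁻¹' {x | x = 0} = {0} := by ext n; simp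
  rw [h2, poissonMeasure_singleton]
  have h3 : ((ENNReal.ofReal l).toNNReal : ℝ) = l := ENNReal.toReal_ofReal hl
  simp [h3]

theorem IsHomogeneousPoissonProcess.ae_nonempty {Ω : Type*} [MeasurableSpace Ω]
    {P : Measure Ω} {r : ℝ≥0} {Y : Ω → Closeds ℝ} (hY : IsHomogeneousPoissonProcess P r Y)
    (hr : 0 < r) : ∀ᵐ ω ∂P, (Y ω : Set ℝ).Nonempty := by
  have hle : ∀ n : ℕ, P {ω | ¬ (Y ω : Set ℝ).Nonempty} ≤
      ENNReal.ofReal (Real.exp (-((r : ℝ) * n))) := by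
    intro n
    rw [← neg_mul, ← hY.measure_inter_Icc_eq_empty 0 n.cast_nonneg]
    refine measure_mono fun ω hω => ?_
    rw [mem_ofPred_eq, not_nonempty_iff_eq_empty] at hω
    simp [hω]
  have hlim : Tendsto (fun n : ℕ => ENNReal.ofReal (Real.exp (-((r : ℝ) * n)))) atTop (𝓝 0) := by
    rw [← ENNReal.ofReal_zero]
    refine ENNReal.tendsto_ofReal (Real.tendsto_exp_neg_atTop_nhds_zero.comp ?_)
    exact tendsto_natCast_atTop_atTop.const_mul_atTop (by exact_mod_cast hr)
  exact le_antisymm (ge_of_tendsto' hlim hle) zero_le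

/-- If the void probabilities of an interval are not summable over `A`, then almost surely some
member of the family indexed by `A` misses that interval. -/
theorem ae_exists_inter_Icc_eq_empty {Ω ι : Type*} [MeasurableSpace Ω] {P : Measure Ω}
    [IsProbabilityMeasure P] [Countable ι] {lam : ι → ℝ≥0} {Y : ι → Ω → Closeds ℝ}
    (hY : ∀ x, IsHomogeneousPoissonProcess P (lam x) (Y x)) (hindep : IndepRandomClosedSets P Y)
    {A : Set ι} (a : ℝ) {l : ℝ} (hl : 0 ≤ l)
    (hA : ¬ Summable (A.indicator fun x => Real.exp (-(lam x : ℝ) * l))) :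
    ∀ᵐ ω ∂P, ∃ x ∈ A, (Y x ω : Set ℝ) ∩ Icc a (a + l) = ∅ := by
  have hA' : ¬ Summable (fun x : A => Real.exp (-(lam x : ℝ) * l)) := fun h =>
    hA (summable_subtype_iff_indicator.1 h)
  have : Infinite A := by
    by_contra hinf
    rw [not_infinite_iff_finite] at hinf
    exact hA' (Summable.of_finite)
  obtain ⟨_⟩ := nonempty_denumerable A
  let e : ℕ ≃ A := (Denumerable.eqv A).symm
  let E : Set (Closeds ℝ) := {F | (F : Set ℝ) ∩ Icc a (a + l) = ∅}
  have hE : MeasurableSet[fellBorel] E := measurableSet_fellBorel_inter_eq_empty isCompact_Icc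
  have hmeas : ∀ n, MeasurableSet (Y (e n) ⁻¹' E) := fun n => (hY (e n)).isRandomClosedSet hE
  have hind : iIndepSet (fun n => Y (e n) ⁻¹' E) P := by
    rw [iIndepSet_iff_meas_biInter hmeas]
    intro S
    have hpre := iIndepFun.precomp (g := fun n => (e n : ι))
      (Subtype.val_injective.comp e.injective) hindep
    exact hpre.meas_biInter fun n _ => ⟨E, hE, rfl⟩
  have hsum : ∑' n, P (Y (e n) ⁻¹' E) = ∞ := by
    by_contra hne
    apply hA'
    rw [← e.summable_iff]
    refine (ENNReal.summable_toReal hne).congr fun n => ?_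
    have : P (Y (e n) ⁻¹' E) = _ := (hY (e n)).measure_inter_Icc_eq_empty a hl
    rw [this, ENNReal.toReal_ofReal (Real.exp_nonneg _)]
    rfl
  have h1 := measure_limsup_eq_one hmeas hind hsum
  have hae : ∀ᵐ ω ∂P, ω ∈ limsup (fun n => Y (e n) ⁻¹' E) atTop :=
    (mem_ae_iff_prob_eq_one (MeasurableSet.measurableSet_limsup hmeas)).2 h1
  filter_upwards [hae] with ω hω
  obtain ⟨n, hn⟩ := (mem_limsup_iff_frequently_mem.1 hω).exists
  exact ⟨e n, (e n).2, hn⟩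

theorem theorem1 {Ω : Type*} [MeasurableSpace Ω] (P : Measure Ω) [IsProbabilityMeasure P]
    [P.IsComplete] (X : Set ℝ) (hX_countable : X.Countable) (hX_infinite : X.Infinite)
    (hX_bounded : Bornology.IsBounded X) (lam : X → ℝ≥0) (hlam : ∀ x, 0 < lam x)
    (Y : X → Ω → Closeds ℝ)
    (hY_poisson : ∀ x, IsHomogeneousPoissonProcess P (lam x) (Y x))
    (hY_indep : IndepRandomClosedSets P Y) :
    ((∀ ε : ℝ, 0 < ε → Summable (fun x : X => Real.exp (-(lam x : ℝ) * ε))) →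
      ∀ᵐ ω ∂P, IsPathConnected (perforatedPlane X (fun x => Y x ω))) ∧
    (¬ (∀ ε : ℝ, 0 < ε → Summable (fun x : X => Real.exp (-(lam x : ℝ) * ε))) →
      ∀ᵐ ω ∂P, ¬ IsPathConnected (perforatedPlane X (fun x => Y x ω))) := by
  have := hX_countable.to_subtype
  refine ⟨fun hsum => ?_, fun hsum => ?_⟩
  · have hne : ∀ᵐ ω ∂P, ∀ x, (Y x ω : Set ℝ).Nonempty :=
      ae_all_iff.2 fun x => (hY_poisson x).ae_nonempty (hlam x)
    have hfin : ∀ᵐ ω ∂P, ∀ (n : ℕ) (k : ℤ), {x | (Y x ω : Set ℝ) ∩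
        Icc ((k : ℝ) / (n + 1)) (k / (n + 1) + 1 / (n + 1)) = ∅}.Finite := by
      refine ae_all_iff.2 fun n => ae_all_iff.2 fun k => ?_
      have hn : (0 : ℝ) < 1 / (n + 1) := by positivity
      refine ae_finite_setOfPred_mem (s := fun x => {ω | (Y x ω : Set ℝ) ∩
        Icc ((k : ℝ) / (n + 1)) (k / (n + 1) + 1 / (n + 1)) = ∅}) ?_
      simp_rw [(hY_poisson _).measure_inter_Icc_eq_empty _ hn.le]
      exact (hsum _ hn).tsum_ofReal_ne_top
    filter_upwards [hne, hfin] with ω h1 h2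
    exact isPathConnected_perforatedPlane hX_bounded.bddAbove h1 h2
  · push Not at hsum
    obtain ⟨ε, hε, hns⟩ := hsum
    obtain ⟨p, s, hs, hdiv⟩ :=
      exists_one_sided_not_summable hX_bounded (fun x => Real.exp_nonneg _) hns
    -- Rational centres leave countably many events, so one null set serves for all.
    have hmiss : ∀ᵐ ω ∂P, ∀ (n : ℕ) (q : ℚ), ∃ x : X,
        (0 < s * (x - p) ∧ s * (x - p) < 1 / (n + 1)) ∧
        (Y x ω : Set ℝ) ∩ Icc (q - ε / 2 : ℝ) (q - ε / 2 + ε) = ∅ :=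
      ae_all_iff.2 fun n => ae_all_iff.2 fun q =>
        ae_exists_inter_Icc_eq_empty hY_poisson hY_indep _ hε.le (hdiv _ (by positivity))
    filter_upwards [hmiss] with ω h
    exact not_isPathConnected_perforatedPlane hX_bounded hs hε h
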